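/- Let $m\ge 2$, let $G:\mathbb{R}\to\mathbb{R}$ be smooth and even, let $g:\mathbb{R}\to\mathbb{R}$ be the solution of $g''=Gg$, $g(0)=0$, $g'(0)=1$, and let $r_{-G}\in(0,+\infty]$ be the first zero of $g$ on $(0,+\infty)$ ($r_{-G}=+\infty$ if there is none). Let $M^m_{-G}=\bigl([0,r_{-G})\times\mathbf{S}^{m-1},\,dr^2+g(r)^2d\theta^2\bigr)$ be the model manifold, with $\{0\}\times\mathbf{S}^{m-1}$ collapsed to the pole $o$; equivalently, in the coordinates $x=r\theta$, it is the open ball of radius $r_{-G}$ about the origin of $\mathbb{R}^m$ with this metric, and $r(x)=|x|$. Let $D$ be its Levi-Civita connection and, for smooth vector fields $X,Y,Z$ on $M^m_{-G}$, put $(DDZ)(X,Y)=D_XD_YZ-D_{D_XY}Z$. Let $K:[0,r_{-G})\to\mathbb{R}$ be smooth, and consider the system $$(DDZ)(X,Y)=K(r(x))\,\langle Z,X\rangle\,Y\qquad\text{for all smooth vector fields }X,Y\text{ on }M^m_{-G}.\tag{$*$}$$ Call a smooth vector field $Z$ on $M^m_{-G}$ a radial gradient field if $Z=\nabla u$ for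 a smooth function $u$ on $M^m_{-G}$ of the form $u(x)=\alpha(r(x))$. Then $(*)$ has a radial gradient solution $Z\not\equiv 0$ if and only if $K(t)=G(t)$ for every $t\in[0,r_{-G})$. In this case, the radial gradient solutions $Z\not\equiv 0$ of $(*)$ are exactly the vector fields $$Z_x=\nabla\Bigl(A\int_0^{r(x)}g(s)\,ds+B\Bigr),\qquad A\in\mathbb{R}\setminus\{0\},\ B\in\mathbb{R}.$$ -/

import Mathlib

open scoped ContDiff InnerProductSpace

noncomputable section

namespace ModelManifold

/-! ### Riemannian geometry of an open subset of a vector space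

A Riemannian metric in a global chart is a map `h` sending a point `x` to the bilinear form `h x`
on the tangent space `E`. Vector fields and functions are given by their expressions in that chart;
all operators below depend only on their values near the point considered. -/

section Chart

variable {E : Type*} [NormedAddCommGroup E] [NormedSpace ℝ E]

/-- The Riemannian gradient `∇u`, i.e. the vector with `⟨∇u, v⟩ = du(v)` for all `v`. -/
def grad (h : E → E →L[ℝ] E →L[ℝ] ℝ) (u : E → ℝ) (x : E) : E :=
  (h x).inverse (fderiv ℝ u x)

/-- The Christoffel symbols of the second kind, as a vector-valued map: `Γ_x(v, w)` is the vector
with `⟨Γ_x(v, w), z⟩ = (1/2) (∂_v h(w, z) + ∂_w h(v, z) - ∂_z h(v, w))` for all `z`. -/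
def christoffel (h : E → E →L[ℝ] E →L[ℝ] ℝ) (x v w : E) : E :=
  (h x).inverse ((1 / 2 : ℝ) •
    (fderiv ℝ h x v w + fderiv ℝ h x w v - ((fderiv ℝ h x).flip v).flip w))

/-- The Levi-Civita covariant derivative `D_X Y`. -/
def covDeriv (h : E → E →L[ℝ] E →L[ℝ] ℝ) (X Y : E → E) (x : E) : E :=
  fderiv ℝ Y x (X x) + christoffel h x (X x) (Y x)

/-- The second covariant derivative `(DDZ)(X, Y) = D_X D_Y Z - D_{D_X Y} Z`. -/
def secondCovDeriv (h : E → E →L[ℝ] E →L[ℝ] ℝ) (Z X Y : E → E) (x : E) : E :=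
  covDeriv h X (covDeriv h Y Z) x - covDeriv h (covDeriv h X Y) Z x

end Chart

/-! ### The model manifold -/

/-- `g` is the solution on `ℝ` of `g'' = G g`, `g(0) = 0`, `g'(0) = 1`. -/
structure IsWarpingFunction (G g : ℝ → ℝ) : Prop where
  differentiable : Differentiable ℝ g
  ode : ∀ t, HasDerivAt (deriv g) (G t * g t) t
  zero : g 0 = 0
  deriv_zero : deriv g 0 = 1

/-- The first zero of `g` on `(0, +∞)`, equal to `+∞` if there is none. -/
def firstZero (g : ℝ → ℝ) : EReal :=
  sInf {R : EReal | ∃ t : ℝ, 0 < t ∧ g t = 0 ∧ R = (t : EReal)}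

/-- The half-open interval `[0, R)` of values of the radial coordinate, `R` the first zero. -/
def radii (g : ℝ → ℝ) : Set ℝ :=
  {t : ℝ | 0 ≤ t ∧ (t : EReal) < firstZero g}

/-- The underlying manifold `[0, R) × S^{m-1}`, with `{0} × S^{m-1}` collapsed to the pole: through
polar coordinates `(r, θ) ↦ r θ` it is the open ball of radius `R` in `ℝ^m`, the pole is the
origin, and the radial coordinate is `r(x) = ‖x‖`. -/
def carrier (m : ℕ) (g : ℝ → ℝ) : Set (EuclideanSpace ℝ (Fin m)) :=
  {x | ((‖x‖ : ℝ) : EReal) < firstZero g}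

/-- The Euclidean inner product of `ℝ^m` as a bilinear form. -/
def euclid (m : ℕ) :
    EuclideanSpace ℝ (Fin m) →L[ℝ] EuclideanSpace ℝ (Fin m) →L[ℝ] ℝ :=
  innerSL ℝ

@[simp]
theorem euclid_apply (m : ℕ) (v w : EuclideanSpace ℝ (Fin m)) : euclid m v w = ⟪v, w⟫_ℝ := rfl

open Classical in
/-- The metric `dr² + g(r)² dθ²` in the chart `x = r θ`. Since `dr(v) = ⟨x, v⟩ / r` and
`r² dθ² = ⟨·,·⟩ - dr²` for the Euclidean product, it is `(g/r)² ⟨·,·⟩ + (1 - (g/r)²) dr²` away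
from the pole, and it is the Euclidean product at the pole. -/
def metric (m : ℕ) (g : ℝ → ℝ) (x : EuclideanSpace ℝ (Fin m)) :
    EuclideanSpace ℝ (Fin m) →L[ℝ] EuclideanSpace ℝ (Fin m) →L[ℝ] ℝ :=
  if x = 0 then euclid m
  else (g ‖x‖ / ‖x‖) ^ 2 • euclid m
    + ((1 - (g ‖x‖ / ‖x‖) ^ 2) / ‖x‖ ^ 2) • (euclid m x).smulRight (euclid m x)

/-- In polar coordinates the metric is `dr² + g(r)² dθ²`: at `x = t θ`, the differential of
`(r, θ) ↦ r θ` sends `(a, τ)`, with `τ` tangent to the unit sphere at `θ`, to `a θ + t τ`. -/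
theorem metric_polar (m : ℕ) (g : ℝ → ℝ) {θ τ σ : EuclideanSpace ℝ (Fin m)} {t : ℝ} (ht : 0 < t)
    (hθ : ‖θ‖ = 1) (hτ : ⟪θ, τ⟫_ℝ = 0) (hσ : ⟪θ, σ⟫_ℝ = 0) (a b : ℝ) :
    metric m g (t • θ) (a • θ + t • τ) (b • θ + t • σ) = a * b + g t ^ 2 * ⟪τ, σ⟫_ℝ := by
  have h0 : θ ≠ 0 := by
    rintro rfl
    simp at hθ
  have hx : t • θ ≠ 0 := smul_ne_zero ht.ne' h0
  have hn : ‖t • θ‖ = t := by rw [norm_smul, hθ, Real.norm_of_nonneg ht.le, mul_one]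
  have hθθ : ⟪θ, θ⟫_ℝ = 1 := by rw [real_inner_self_eq_norm_sq, hθ, one_pow]
  have hτ' : ⟪τ, θ⟫_ℝ = 0 := by rw [real_inner_comm]; exact hτ
  simp only [metric, if_neg hx, hn]
  simp only [add_apply, smul_apply,
    ContinuousLinearMap.smulRight_apply, euclid_apply, smul_eq_mul, inner_add_left,
    inner_add_right, real_inner_smul_left, real_inner_smul_right, hθθ, hτ, hσ, hτ']
  field_simp
  ring

/-- `Z` is a smooth vector field on the model with
`(DDZ)(X, Y) = K(r) ⟨Z, X⟩ Y` for all smooth vector fields `X`, `Y`. -/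
def IsSolution (m : ℕ) (g K : ℝ → ℝ)
    (Z : EuclideanSpace ℝ (Fin m) → EuclideanSpace ℝ (Fin m)) : Prop :=
  ContDiffOn ℝ ∞ Z (carrier m g) ∧
    ∀ X Y : EuclideanSpace ℝ (Fin m) → EuclideanSpace ℝ (Fin m),
      ContDiffOn ℝ ∞ X (carrier m g) → ContDiffOn ℝ ∞ Y (carrier m g) →
        ∀ x ∈ carrier m g,
          secondCovDeriv (metric m g) Z X Y x = (K ‖x‖ * metric m g x (Z x) (X x)) • Y x

/-- `Z` is a radial gradient field: `Z = ∇u` for a smooth `u` of the form `u(x) = α(r(x))`. -/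
def IsRadialGradient (m : ℕ) (g : ℝ → ℝ)
    (Z : EuclideanSpace ℝ (Fin m) → EuclideanSpace ℝ (Fin m)) : Prop :=
  ∃ α : ℝ → ℝ, ContDiffOn ℝ ∞ (fun x : EuclideanSpace ℝ (Fin m) => α ‖x‖) (carrier m g) ∧
    ∀ x ∈ carrier m g, Z x = grad (metric m g) (fun x => α ‖x‖) x

/-- `Z` is a non-trivial radial gradient solution of `(DDZ)(X, Y) = K(r) ⟨Z, X⟩ Y`. -/
structure IsNontrivialRadialGradientSolution (m : ℕ) (g K : ℝ → ℝ)
    (Z : EuclideanSpace ℝ (Fin m) → EuclideanSpace ℝ (Fin m)) : Prop where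
  solution : IsSolution m g K Z
  radial : IsRadialGradient m g Z
  nontrivial : ∃ x ∈ carrier m g, Z x ≠ 0

end ModelManifold

end

noncomputable section

set_option maxSynthPendingDepth 3

namespace ModelManifold

/-! ### Smoothness of even functions of the norm -/

/-! Away from the pole a radial gradient is `Z = z(r) ∂_r` with `z = α'`, and `D_Y Z = p Y + (z' -
p) ⟨∂_r, Y⟩ ∂_r` with `p = z g'/g`. Differentiating along `∂_r`, the system gives `z'' = K z` from
the radial direction and `(z g'/g)' = K z` from a tangential one (`polar_equations`). Subtracting,
`z' - z g'/g` is a constant `C`; expanding the tangential equation with `g'' = G g` then gives `(K -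
G) z g = C g'`. At the pole the left side tends to `0` and `g'` to `1`, so `C = 0`. Hence `z = A g`,
and `K = G` wherever `z ≠ 0` (`proportional_of_polar_equations`, `rigid`). Conversely, `Z = A g ∂_r`
satisfies `D_Y Z = A g' Y` (`covDeriv_conformal`), so only the derivative of `g'` survives in `DDZ`,
and it is `G g dr`. Smoothness at the pole holds because `g` is odd: an even smooth function of the
norm is smooth. -/

/-- The moments `∫₀¹ s^k φ(s r) ds`. -/
def rayMoment (k : ℕ) (φ : ℝ → ℝ) (r : ℝ) : ℝ := ∫ s in (0 : ℝ)..1, s ^ k * φ (s * r)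

/-- Differentiating under the integral sign brings out a factor `s`. Carrying the exponent `k` makes
the family of moments stable under differentiation. -/
theorem hasDerivAt_rayMoment (k : ℕ) {φ : ℝ → ℝ} (hφ : ContDiff ℝ 1 φ) (r : ℝ) :
    HasDerivAt (rayMoment k φ) (rayMoment (k + 1) (deriv φ) r) r := by
  have hd : Continuous (deriv φ) := hφ.continuous_deriv le_rfl
  have hc : Continuous φ := hφ.continuous
  obtain ⟨C, hC⟩ := (isCompact_Icc (a := -(|r| + 1)) (b := |r| + 1)).exists_bound_of_continuousOn
    hd.continuousOn
  refine (intervalIntegral.hasDerivAt_integral_of_dominated_loc_of_deriv_le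
    (F := fun x s => s ^ k * φ (s * x)) (F' := fun x s => s ^ (k + 1) * deriv φ (s * x))
    (bound := fun _ => C) (Metric.ball_mem_nhds r one_pos) ?_ ?_ ?_ ?_ ?_ ?_).2
  · exact Filter.Eventually.of_forall fun x => (by fun_prop : Continuous _).aestronglyMeasurable
  · exact (by fun_prop : Continuous fun s => s ^ k * φ (s * r)).intervalIntegrable _ _
  · exact (by fun_prop : Continuous fun s => s ^ (k + 1) * deriv φ (s * r)).aestronglyMeasurable
  · refine Filter.Eventually.of_forall fun s hs x hx => ?_
    rw [Set.uIoc_of_le zero_le_one] at hs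
    have hx' : |x| ≤ |r| + 1 := by
      have h1 : |x - r| < 1 := by simpa [Real.dist_eq] using hx
      have h2 := abs_sub_abs_le_abs_sub x r
      linarith
    have hsx : |s * x| ≤ |r| + 1 := by
      rw [abs_mul, abs_of_pos hs.1]
      exact (mul_le_of_le_one_left (abs_nonneg x) hs.2).trans hx'
    have hs' : |s ^ (k + 1)| ≤ 1 := by
      rw [abs_of_nonneg (by have := hs.1; positivity)]
      exact pow_le_one₀ hs.1.le hs.2
    rw [norm_mul, Real.norm_eq_abs (s ^ (k + 1))]
    exact (mul_le_of_le_one_left (norm_nonneg _) hs').trans (hC _ (abs_le.mp hsx))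
  · exact intervalIntegrable_const
  · refine Filter.Eventually.of_forall fun s _ x _ => ?_
    have h1 : HasDerivAt φ (deriv φ (s * x)) (s * x) :=
      (hφ.differentiable one_ne_zero _).hasDerivAt
    have h2 : HasDerivAt (fun x : ℝ => s * x) s x := by
      simpa using (hasDerivAt_id x).const_mul s
    exact ((h1.comp x h2).const_mul (s ^ k)).congr_deriv (by ring)

theorem contDiff_rayMoment {φ : ℝ → ℝ} (hφ : ContDiff ℝ ∞ φ) (k : ℕ) :
    ContDiff ℝ ∞ (rayMoment k φ) := by
  have H : ∀ n : ℕ, ∀ (k : ℕ) (φ : ℝ → ℝ), ContDiff ℝ ∞ φ → ContDiff ℝ n (rayMoment k φ) := by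
    intro n
    induction n with
    | zero =>
      intro k φ hφ
      refine contDiff_zero.mpr (continuous_iff_continuousAt.mpr fun r => ?_)
      exact (hasDerivAt_rayMoment k (hφ.of_le (by simp)) r).continuousAt
    | succ n ih =>
      intro k φ hφ
      have h := hasDerivAt_rayMoment k (hφ.of_le (by simp : (1 : WithTop ℕ∞) ≤ ∞))
      rw [Nat.cast_succ, contDiff_succ_iff_deriv]
      refine ⟨fun r => (h r).differentiableAt, by simp, ?_⟩
      rw [show deriv (rayMoment k φ) = rayMoment (k + 1) (deriv φ) from funext fun r => (h r).deriv]
      exact ih _ _ (contDiff_infty_iff_deriv.mp hφ).2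
  exact contDiff_infty.mpr fun n => H n k φ hφ

/-- Hadamard's lemma on the line. -/
theorem mul_rayMoment_deriv {φ : ℝ → ℝ} (hφ : ContDiff ℝ 1 φ) (h0 : φ 0 = 0) (r : ℝ) :
    r * rayMoment 0 (deriv φ) r = φ r := by
  have h := intervalIntegral.mul_integral_comp_mul_right (f := deriv φ) (a := 0) (b := 1) r
  simp only [rayMoment, pow_zero, one_mul]
  rw [h, intervalIntegral.integral_deriv_eq_sub]
  · simp [h0]
  · exact fun x _ => hφ.differentiable one_ne_zero x
  · exact (hφ.continuous_deriv le_rfl).intervalIntegrable _ _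

theorem deriv_neg_of_even {φ : ℝ → ℝ} (he : ∀ t, φ (-t) = φ t) (t : ℝ) :
    deriv φ (-t) = -deriv φ t := by
  have h := deriv_comp_neg φ t
  rw [show (fun x => φ (-x)) = φ from funext he] at h
  linarith

theorem deriv_neg_of_odd {φ : ℝ → ℝ} (ho : ∀ t, φ (-t) = -φ t) (t : ℝ) :
    deriv φ (-t) = deriv φ t := by
  have h := deriv_comp_neg φ t
  rw [show (fun x => φ (-x)) = fun x => -φ x from funext ho, deriv.fun_neg] at h
  linarith

/-- The even smooth function `φ'(r) / r` attached to an even smooth function `φ`. -/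
def radialDeriv (φ : ℝ → ℝ) : ℝ → ℝ := rayMoment 0 (deriv (deriv φ))

section Radial

variable {φ : ℝ → ℝ}

theorem contDiff_radialDeriv (hφ : ContDiff ℝ ∞ φ) : ContDiff ℝ ∞ (radialDeriv φ) :=
  contDiff_rayMoment (contDiff_infty_iff_deriv.mp (contDiff_infty_iff_deriv.mp hφ).2).2 0

theorem radialDeriv_neg (he : ∀ t, φ (-t) = φ t) (t : ℝ) :
    radialDeriv φ (-t) = radialDeriv φ t := by
  have h := deriv_neg_of_odd (deriv_neg_of_even he)
  simp only [radialDeriv, rayMoment, mul_neg, h]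

theorem deriv_zero_of_even (he : ∀ t, φ (-t) = φ t) : deriv φ 0 = 0 := by
  have h := deriv_neg_of_even he 0
  rw [neg_zero] at h
  linarith

theorem mul_radialDeriv (hφ : ContDiff ℝ ∞ φ) (he : ∀ t, φ (-t) = φ t) (r : ℝ) :
    r * radialDeriv φ r = deriv φ r :=
  mul_rayMoment_deriv ((contDiff_infty_iff_deriv.mp hφ).2.of_le (by simp))
    (deriv_zero_of_even he) r

theorem radialDeriv_zero : radialDeriv φ 0 = deriv (deriv φ) 0 := by
  simp [radialDeriv, rayMoment]

variable {F : Type*} [NormedAddCommGroup F] [InnerProductSpace ℝ F]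

theorem hasFDerivAt_norm_of_ne_zero {x : F} (hx : x ≠ 0) :
    HasFDerivAt (fun y : F => ‖y‖) ((1 / ‖x‖) • innerSL ℝ x) x := by
  have hn : ‖x‖ ≠ 0 := norm_ne_zero_iff.mpr hx
  have h := (hasStrictFDerivAt_norm_sq x).hasFDerivAt.sqrt (pow_ne_zero 2 hn)
  simp only [Real.sqrt_sq (norm_nonneg _)] at h
  convert h using 1
  ext v
  simp
  field_simp

theorem hasFDerivAt_comp_norm {φ' : ℝ} {x : F} (hx : x ≠ 0) (h : HasDerivAt φ φ' ‖x‖) :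
    HasFDerivAt (fun y : F => φ ‖y‖) ((φ' / ‖x‖) • innerSL ℝ x) x := by
  have := h.comp_hasFDerivAt x (hasFDerivAt_norm_of_ne_zero hx)
  rw [smul_smul, mul_one_div] at this
  exact this

/-- The norm is not differentiable at the origin, but `φ(‖y‖) - φ(0) = o(‖y‖)` suffices. -/
theorem hasFDerivAt_comp_norm_zero (h : HasDerivAt φ 0 0) :
    HasFDerivAt (fun y : F => φ ‖y‖) (0 : F →L[ℝ] ℝ) 0 := by
  rw [hasFDerivAt_iff_isLittleO_nhds_zero]
  rw [hasDerivAt_iff_isLittleO_nhds_zero] at h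
  have ht : Filter.Tendsto (fun y : F => ‖y‖) (nhds 0) (nhds 0) := by
    simpa using (continuous_norm (E := F)).tendsto 0
  have := h.comp_tendsto ht
  refine Asymptotics.IsLittleO.of_norm_right ?_
  simpa [Function.comp_def] using this

theorem hasFDerivAt_comp_norm_of_even (hφ : ContDiff ℝ ∞ φ) (he : ∀ t, φ (-t) = φ t) (x : F) :
    HasFDerivAt (fun y : F => φ ‖y‖) (radialDeriv φ ‖x‖ • innerSL ℝ x) x := by
  have hd : ∀ t, HasDerivAt φ (deriv φ t) t := fun t =>
    (hφ.differentiable (by simp) t).hasDerivAt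
  rcases eq_or_ne x 0 with rfl | hx
  · have h0 := hd 0
    rw [deriv_zero_of_even he] at h0
    simpa using hasFDerivAt_comp_norm_zero (F := F) h0
  · convert hasFDerivAt_comp_norm hx (hd ‖x‖) using 2
    rw [← mul_radialDeriv hφ he, mul_div_cancel_left₀ _ (norm_ne_zero_iff.mpr hx)]

/-- An even smooth function of the norm is smooth. -/
theorem contDiff_comp_norm_of_even (hφ : ContDiff ℝ ∞ φ) (he : ∀ t, φ (-t) = φ t) :
    ContDiff ℝ ∞ (fun y : F => φ ‖y‖) := by
  have H : ∀ n : ℕ, ∀ φ : ℝ → ℝ, ContDiff ℝ ∞ φ → (∀ t, φ (-t) = φ t) →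
      ContDiff ℝ n (fun y : F => φ ‖y‖) := by
    intro n
    induction n with
    | zero =>
      intro φ hφ _
      exact contDiff_zero.mpr (hφ.continuous.comp continuous_norm)
    | succ n ih =>
      intro φ hφ he
      rw [Nat.cast_succ, contDiff_succ_iff_hasFDerivAt]
      -- The differential is a linear map in `y` times `radialDeriv φ ‖y‖`, and `radialDeriv φ` is
      -- again even and smooth, so the induction closes.
      exact ⟨_, (ih _ (contDiff_radialDeriv hφ) (radialDeriv_neg he)).smul
        (innerSL ℝ).contDiff, hasFDerivAt_comp_norm_of_even hφ he⟩
  exact contDiff_infty.mpr fun n => H n φ hφ he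

end Radial

/-! ### The warping function -/

section Warping

variable {G g : ℝ → ℝ}

theorem IsWarpingFunction.hasDerivAt (hg : IsWarpingFunction G g) (t : ℝ) :
    HasDerivAt g (deriv g t) t := (hg.differentiable t).hasDerivAt

theorem IsWarpingFunction.contDiff (hg : IsWarpingFunction G g) (hG : ContDiff ℝ ∞ G) :
    ContDiff ℝ ∞ g := by
  have hdd : deriv (deriv g) = fun t => G t * g t := funext fun t => (hg.ode t).deriv
  have H : ∀ n : ℕ, ContDiff ℝ n g ∧ ContDiff ℝ n (deriv g) := by
    intro n
    induction n with
    | zero =>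
      exact ⟨contDiff_zero.mpr hg.differentiable.continuous, contDiff_zero.mpr
        (continuous_iff_continuousAt.mpr fun t => (hg.ode t).continuousAt)⟩
    | succ n ih =>
      rw [Nat.cast_succ, contDiff_succ_iff_deriv, contDiff_succ_iff_deriv]
      refine ⟨⟨hg.differentiable, by simp, ih.2⟩, fun t => (hg.ode t).differentiableAt, by simp, ?_⟩
      rw [hdd]
      exact (contDiff_infty.mp hG n).mul ih.1
  exact contDiff_infty.mpr fun n => (H n).1

/-- Uniqueness, forward in time, for the linear equation `w'' = G w`. -/
theorem eq_zero_of_linear_ode {w v : ℝ → ℝ} (hG : Continuous G)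
    (hw : ∀ t, HasDerivAt w (v t) t) (hv : ∀ t, HasDerivAt v (G t * w t) t)
    (hw0 : w 0 = 0) (hv0 : v 0 = 0) {t : ℝ} (ht : 0 ≤ t) : w t = 0 := by
  obtain ⟨C, hC⟩ := (isCompact_Icc (a := 0) (b := t)).exists_bound_of_continuousOn hG.continuousOn
  -- Grönwall for the first-order system `(w, v)' = (v, G w)`; in the sup norm its Lipschitz
  -- constant is at most `max 1 C`.
  have h := eq_zero_of_abs_deriv_le_mul_abs_self_of_eq_zero_right (a := 0) (b := t)
    (f := fun s => (w s, v s)) (f' := fun s => (v s, G s * w s)) (K := max 1 C)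
    (fun s _ => ((hw s).prodMk (hv s)).continuousAt.continuousWithinAt)
    (fun s _ => ((hw s).prodMk (hv s)).hasDerivWithinAt) (by simp [hw0, hv0]) ?_ t ⟨ht, le_rfl⟩
  · exact congrArg Prod.fst h
  · intro s hs
    have h1 : ‖w s‖ ≤ ‖(w s, v s)‖ := norm_fst_le (w s, v s)
    have h2 : ‖v s‖ ≤ ‖(w s, v s)‖ := norm_snd_le (w s, v s)
    have hCs := (hC s ⟨hs.1, hs.2.le⟩).trans (le_max_right 1 C)
    refine norm_prod_le_iff.mpr ⟨?_, ?_⟩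
    · exact h2.trans (le_mul_of_one_le_left (norm_nonneg _) (le_max_left _ _))
    · simp only [norm_mul]
      exact mul_le_mul hCs h1 (norm_nonneg _) (by positivity)

/-- Since `G` is even, `g(s) + g(-s)` solves the same linear equation with zero initial data. -/
theorem IsWarpingFunction.odd (hg : IsWarpingFunction G g) (hG : Continuous G)
    (he : ∀ t, G (-t) = G t) (t : ℝ) : g (-t) = -g t := by
  have key : ∀ s, 0 ≤ s → g s + g (-s) = 0 := fun s hs =>
    eq_zero_of_linear_ode (G := G) (w := fun s => g s + g (-s))
      (v := fun s => deriv g s - deriv g (-s)) hG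
      (fun s => by
        have h := (hg.hasDerivAt s).add ((hg.hasDerivAt (-s)).comp s (hasDerivAt_neg s))
        exact h.congr_deriv (by ring))
      (fun s => by
        have h := (hg.ode s).sub ((hg.ode (-s)).comp s (hasDerivAt_neg s))
        exact h.congr_deriv (by rw [he]; ring))
      (by simp [hg.zero]) (by simp) hs
  rcases le_total 0 t with ht | ht
  · linarith [key t ht]
  · have := key (-t) (neg_nonneg.mpr ht)
    rw [neg_neg] at this
    linarith

/-- The primitive `∫₀^r g` of the warping function. -/
def warpingPrimitive (g : ℝ → ℝ) (r : ℝ) : ℝ := ∫ s in (0 : ℝ)..r, g s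

theorem IsWarpingFunction.hasDerivAt_primitive (hg : IsWarpingFunction G g) (t : ℝ) :
    HasDerivAt (warpingPrimitive g) (g t) t :=
  hg.differentiable.continuous.integral_hasStrictDerivAt 0 t |>.hasDerivAt

theorem IsWarpingFunction.deriv_primitive (hg : IsWarpingFunction G g) :
    deriv (warpingPrimitive g) = g := funext fun t => (hg.hasDerivAt_primitive t).deriv

theorem IsWarpingFunction.contDiff_primitive (hg : IsWarpingFunction G g) (hG : ContDiff ℝ ∞ G) :
    ContDiff ℝ ∞ (warpingPrimitive g) := by
  rw [contDiff_infty_iff_deriv, hg.deriv_primitive]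
  exact ⟨fun t => (hg.hasDerivAt_primitive t).differentiableAt, hg.contDiff hG⟩

theorem IsWarpingFunction.primitive_even (hg : IsWarpingFunction G g) (hG : Continuous G)
    (he : ∀ t, G (-t) = G t) (t : ℝ) : warpingPrimitive g (-t) = warpingPrimitive g t := by
  have h := intervalIntegral.integral_comp_neg (f := g) (a := 0) (b := t)
  simp only [hg.odd hG he, intervalIntegral.integral_neg, neg_zero] at h
  rw [warpingPrimitive, warpingPrimitive, intervalIntegral.integral_symm]
  linarith

/-! ### The radial interval and the carrier -/

theorem ne_zero_of_mem_radii {t : ℝ} (ht : t ∈ radii g) (h0 : 0 < t) : g t ≠ 0 := fun h =>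
  absurd (sInf_le ⟨t, h0, h, rfl⟩ : firstZero g ≤ (t : EReal)) (not_le.mpr ht.2)

theorem mem_radii_of_le {s t : ℝ} (ht : t ∈ radii g) (h0 : 0 ≤ s) (hst : s ≤ t) : s ∈ radii g :=
  ⟨h0, (EReal.coe_le_coe_iff.mpr hst).trans_lt ht.2⟩

/-- As `g'(0) = 1`, `g` has no zero in a punctured neighbourhood of `0`, so the first zero is
bounded away from `0`. -/
theorem IsWarpingFunction.exists_pos_mem_radii (hg : IsWarpingFunction G g) :
    ∃ t ∈ radii g, 0 < t := by
  have h1 := hg.hasDerivAt 0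
  rw [hg.deriv_zero] at h1
  have h2 := h1.eventually_ne one_ne_zero (c := 0)
  obtain ⟨ε, hε, h⟩ := Metric.mem_nhdsWithin_iff.mp h2
  have hle : (ε : EReal) ≤ firstZero g := by
    refine le_sInf ?_
    rintro _ ⟨s, hs, hgs, rfl⟩
    rw [EReal.coe_le_coe_iff]
    by_contra! hlt
    refine h ⟨?_, hs.ne'⟩ hgs
    simpa [abs_of_pos hs] using hlt
  refine ⟨ε / 2, ⟨(half_pos hε).le, lt_of_lt_of_le ?_ hle⟩, half_pos hε⟩
  exact EReal.coe_lt_coe_iff.mpr (half_lt_self hε)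

theorem IsWarpingFunction.zero_mem_radii (hg : IsWarpingFunction G g) : (0 : ℝ) ∈ radii g := by
  obtain ⟨t, ht, h0⟩ := hg.exists_pos_mem_radii
  exact mem_radii_of_le ht le_rfl h0.le

variable {m : ℕ}

theorem mem_carrier_iff {x : EuclideanSpace ℝ (Fin m)} : x ∈ carrier m g ↔ ‖x‖ ∈ radii g :=
  ⟨fun h => ⟨norm_nonneg x, h⟩, fun h => h.2⟩

theorem isOpen_carrier : IsOpen (carrier m g) :=
  isOpen_Iio.preimage (continuous_coe_real_ereal.comp continuous_norm)

theorem eventually_mem_radii {t : ℝ} (ht : t ∈ radii g) (h0 : 0 < t) :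
    ∀ᶠ s in nhds t, s ∈ radii g ∧ 0 < s := by
  have h1 : ∀ᶠ s : ℝ in nhds t, (s : EReal) < firstZero g :=
    continuous_coe_real_ereal.continuousAt.eventually_lt_const ht.2
  filter_upwards [h1, lt_mem_nhds h0] with s hs hs0 using ⟨⟨hs0.le, hs⟩, hs0⟩

theorem eventually_mem_radii_nhdsGT (hg : IsWarpingFunction G g) :
    ∀ᶠ s in nhdsWithin 0 (Set.Ioi 0), s ∈ radii g ∧ 0 < s := by
  obtain ⟨t, ht, h0⟩ := hg.exists_pos_mem_radii
  filter_upwards [Ioc_mem_nhdsGT h0] with s hs using ⟨mem_radii_of_le ht hs.1.le hs.2, hs.1⟩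

end Warping

/-! ### The connection in a chart -/

section ChartLemmas

variable {E : Type*} [NormedAddCommGroup E] [NormedSpace ℝ E]
  {h : E → E →L[ℝ] E →L[ℝ] ℝ} {X Y Z : E → E} {x : E}

theorem christoffel_smul_right (c : ℝ) (v w : E) :
    christoffel h x v (c • w) = c • christoffel h x v w := by
  simp only [christoffel, map_smul, smul_apply]
  rw [← smul_add, ← smul_sub, map_smul, smul_comm]

theorem christoffel_zero_right (v : E) : christoffel h x v 0 = 0 := by
  simpa using christoffel_smul_right (h := h) (x := x) 0 v 0

theorem covDeriv_congr {Y' : E → E} (hY : Y =ᶠ[nhds x] Y') :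
    covDeriv h X Y x = covDeriv h X Y' x := by
  rw [covDeriv, covDeriv, hY.fderiv_eq, hY.eq_of_nhds]

theorem covDeriv_smul {f : E → ℝ} {f' : E →L[ℝ] ℝ} (hf : HasFDerivAt f f' x)
    (hY : DifferentiableAt ℝ Y x) :
    covDeriv h X (fun y => f y • Y y) x = f' (X x) • Y x + f x • covDeriv h X Y x := by
  rw [covDeriv, covDeriv, (hf.fun_smul hY.hasFDerivAt).fderiv, christoffel_smul_right]
  simp only [add_apply, smul_apply, ContinuousLinearMap.smulRight_apply, smul_add]
  abel

theorem differentiableAt_smul_add_smul_smulRight (L : E →L[ℝ] E →L[ℝ] ℝ) {a b : E → ℝ}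
    (ha : DifferentiableAt ℝ a x) (hb : DifferentiableAt ℝ b x) :
    DifferentiableAt ℝ (fun y => a y • L + b y • (L y).smulRight (L y)) x := by
  have h : DifferentiableAt ℝ
      (fun y => ContinuousLinearMap.smulRightL ℝ E (E →L[ℝ] ℝ) (L y) (L y)) x :=
    ((ContinuousLinearMap.smulRightL ℝ E (E →L[ℝ] ℝ)).comp L).differentiableAt.clm_apply
      L.differentiableAt
  exact (ha.smul_const L).add (hb.smul h)

theorem hasFDerivAt_bilin_apply (hh : DifferentiableAt ℝ h x) (w z : E) :
    HasFDerivAt (fun y => h y w z) (((fderiv ℝ h x).flip w).flip z) x :=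
  (((ContinuousLinearMap.apply ℝ ℝ z).comp (ContinuousLinearMap.apply ℝ (E →L[ℝ] ℝ) w)).hasFDerivAt
    (x := h x)).comp x hh.hasFDerivAt

end ChartLemmas

/-! ### The metric -/

section Metric

variable {m : ℕ} {g : ℝ → ℝ} {x : EuclideanSpace ℝ (Fin m)}

theorem metric_apply (hx : x ≠ 0) (v w : EuclideanSpace ℝ (Fin m)) :
    metric m g x v w = (g ‖x‖ / ‖x‖) ^ 2 * ⟪v, w⟫_ℝ
      + ((1 - (g ‖x‖ / ‖x‖) ^ 2) / ‖x‖ ^ 2) * (⟪x, v⟫_ℝ * ⟪x, w⟫_ℝ) := by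
  simp [metric, hx]

/-- The Gauss lemma in this chart: the factors `(g/r)²` cancel as soon as one argument is radial. -/
theorem metric_self_left (hx : x ≠ 0) (w : EuclideanSpace ℝ (Fin m)) :
    metric m g x x w = ⟪x, w⟫_ℝ := by
  have hn : ‖x‖ ≠ 0 := norm_ne_zero_iff.mpr hx
  rw [metric_apply hx, real_inner_self_eq_norm_sq]
  field_simp
  ring

theorem metric_zero : metric m g 0 = euclid m := by simp [metric]

theorem metric_symm (v w : EuclideanSpace ℝ (Fin m)) : metric m g x v w = metric m g x w v := by
  rcases eq_or_ne x 0 with rfl | hx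
  · simp [metric_zero, real_inner_comm]
  · rw [metric_apply hx, metric_apply hx, real_inner_comm]
    ring

theorem norm_ne_zero_and_warping_ne_zero (hx : x ≠ 0) (hc : x ∈ carrier m g) :
    ‖x‖ ≠ 0 ∧ g ‖x‖ ≠ 0 :=
  ⟨norm_ne_zero_iff.mpr hx, ne_zero_of_mem_radii (mem_carrier_iff.mp hc) (norm_pos_iff.mpr hx)⟩

/-- A vector in the kernel is Euclidean-orthogonal to `x` by the Gauss lemma; on such vectors the
metric is `(g/r)²` times the Euclidean one, with `g ≠ 0`. Equality of dimensions does the rest. -/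
theorem isInvertible_metric (hc : x ∈ carrier m g) : (metric m g x).IsInvertible := by
  have hinj : Function.Injective (metric m g x) := by
    refine (injective_iff_map_eq_zero _).mpr fun v hv => ?_
    rcases eq_or_ne x 0 with rfl | hx
    · rw [metric_zero] at hv
      simpa using congrArg (fun φ => φ v) hv
    · have hne := norm_ne_zero_and_warping_ne_zero hx hc
      have h1 : ⟪x, v⟫_ℝ = 0 := by
        rw [← metric_self_left (g := g) hx, metric_symm, hv]
        rfl
      have h2 : metric m g x v v = 0 := by rw [hv]; rfl
      rw [metric_apply hx, h1] at h2
      simpa [hne.1, hne.2] using h2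
  have hdim : Module.finrank ℝ (EuclideanSpace ℝ (Fin m)) =
      Module.finrank ℝ (EuclideanSpace ℝ (Fin m) →L[ℝ] ℝ) := by
    rw [← (LinearMap.toContinuousLinearMap (𝕜 := ℝ) (E := EuclideanSpace ℝ (Fin m))
      (F' := ℝ)).finrank_eq]
    exact (Subspace.dual_finrank_eq (K := ℝ)).symm
  refine ⟨(LinearEquiv.ofInjectiveOfFinrankEq (metric m g x).toLinearMap hinj
    hdim).toContinuousLinearEquiv, ?_⟩
  ext v w
  rfl

section Derivative

variable {a' b' : ℝ}

theorem fderiv_metric_apply (hx : x ≠ 0)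
    (ha : HasDerivAt (fun t => (g t / t) ^ 2) a' ‖x‖)
    (hb : HasDerivAt (fun t => (1 - (g t / t) ^ 2) / t ^ 2) b' ‖x‖)
    (v w z : EuclideanSpace ℝ (Fin m)) :
    fderiv ℝ (metric m g) x v w z = a' / ‖x‖ * ⟪x, v⟫_ℝ * ⟪w, z⟫_ℝ
      + (b' / ‖x‖ * ⟪x, v⟫_ℝ * (⟪x, w⟫_ℝ * ⟪x, z⟫_ℝ)
        + (1 - (g ‖x‖ / ‖x‖) ^ 2) / ‖x‖ ^ 2 * (⟪v, w⟫_ℝ * ⟪x, z⟫_ℝ + ⟪x, w⟫_ℝ * ⟪v, z⟫_ℝ)) := by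
  have hfa := hasFDerivAt_comp_norm (F := EuclideanSpace ℝ (Fin m)) hx ha
  have hfb := hasFDerivAt_comp_norm (F := EuclideanSpace ℝ (Fin m)) hx hb
  have heq : metric m g =ᶠ[nhds x] fun y => (g ‖y‖ / ‖y‖) ^ 2 • euclid m
      + ((1 - (g ‖y‖ / ‖y‖) ^ 2) / ‖y‖ ^ 2) • (euclid m y).smulRight (euclid m y) := by
    filter_upwards [isOpen_ne.mem_nhds hx] with y hy
    rw [metric, if_neg hy]
  have hd : DifferentiableAt ℝ (metric m g) x :=
    (differentiableAt_smul_add_smul_smulRight (euclid m) hfa.differentiableAt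
      hfb.differentiableAt).congr_of_eventuallyEq heq
  have h1 := hasFDerivAt_bilin_apply hd w z
  have hin : ∀ u : EuclideanSpace ℝ (Fin m),
      HasFDerivAt (fun y : EuclideanSpace ℝ (Fin m) => ⟪y, u⟫_ℝ) (innerSL ℝ u) x := fun u => by
    simpa only [← innerSL_apply_apply ℝ u, real_inner_comm] using (innerSL ℝ u).hasFDerivAt (x := x)
  have h2 := (hfa.mul_const ⟪w, z⟫_ℝ).fun_add (hfb.fun_mul ((hin w).fun_mul (hin z)))
  have h3 := h2.congr_of_eventuallyEq (f₁ := fun y => metric m g y w z) (by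
    filter_upwards [isOpen_ne.mem_nhds hx] with y hy
    exact metric_apply hy w z)
  have h4 := congrArg (fun L => L v) (h1.unique h3)
  simp only [ContinuousLinearMap.flip_apply, add_apply, smul_apply, innerSL_apply_apply, smul_eq_mul] at h4
  rw [h4, real_inner_comm v w, real_inner_comm v z]
  ring

end Derivative

theorem hasDerivAt_warping_quotient_sq {t g' : ℝ} (ht : t ≠ 0) (hg : HasDerivAt g g' t) :
    HasDerivAt (fun t => (g t / t) ^ 2) (2 * (g t / t) * ((g' * t - g t) / t ^ 2)) t := by
  have := (hg.fun_div (hasDerivAt_id' t) ht).fun_pow 2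
  exact this.congr_deriv (by simp)

theorem hasDerivAt_radial_coefficient {t g' : ℝ} (ht : t ≠ 0) (hg : HasDerivAt g g' t) :
    HasDerivAt (fun t => (1 - (g t / t) ^ 2) / t ^ 2)
      ((-(2 * (g t / t) * ((g' * t - g t) / t ^ 2)) * t ^ 2 - (1 - (g t / t) ^ 2) * (2 * t))
        / (t ^ 2) ^ 2) t := by
  have := ((hasDerivAt_warping_quotient_sq ht hg).const_sub 1).fun_div (hasDerivAt_pow 2 t)
    (pow_ne_zero 2 ht)
  exact this.congr_deriv (by simp)

variable {g' : ℝ}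

theorem christoffel_metric_symm (hx : x ≠ 0) (hg : HasDerivAt g g' ‖x‖)
    (v w : EuclideanSpace ℝ (Fin m)) :
    christoffel (metric m g) x v w = christoffel (metric m g) x w v := by
  have hn : ‖x‖ ≠ 0 := norm_ne_zero_iff.mpr hx
  have hF := fderiv_metric_apply hx (hasDerivAt_warping_quotient_sq hn hg)
    (hasDerivAt_radial_coefficient hn hg)
  rw [christoffel, christoffel]
  congr 1
  ext z
  simp only [add_apply, smul_apply, sub_apply, ContinuousLinearMap.flip_apply, hF,
    real_inner_comm v w, smul_eq_mul]
  ring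

/-- The only Christoffel symbols a radial field requires. Pairing both sides with a test vector
avoids computing the inverse metric. -/
theorem christoffel_metric_self (hx : x ≠ 0) (hc : x ∈ carrier m g) (hg : HasDerivAt g g' ‖x‖)
    (v : EuclideanSpace ℝ (Fin m)) :
    christoffel (metric m g) x v x =
      (‖x‖ * g' / g ‖x‖ - 1) • (v - (⟪x, v⟫_ℝ / ‖x‖ ^ 2) • x) := by
  obtain ⟨hn, hgn⟩ := norm_ne_zero_and_warping_ne_zero hx hc
  have hF := fderiv_metric_apply hx (hasDerivAt_warping_quotient_sq hn hg)
    (hasDerivAt_radial_coefficient hn hg)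
  rw [christoffel, (isInvertible_metric hc).inverse_apply_eq]
  ext z
  simp only [add_apply, smul_apply, sub_apply, ContinuousLinearMap.flip_apply, hF, map_smul,
    map_sub, smul_eq_mul, metric_self_left hx, metric_apply hx, real_inner_self_eq_norm_sq,
    real_inner_comm x v, real_inner_comm x z, real_inner_comm v z]
  field_simp
  ring

/-- The covariant derivative of a radial vector field `c(r) x`. -/
theorem covDeriv_radial {c : ℝ → ℝ} {c' : ℝ} {Y Z : EuclideanSpace ℝ (Fin m) →
    EuclideanSpace ℝ (Fin m)} (hx : x ≠ 0) (hc : x ∈ carrier m g) (hg : HasDerivAt g g' ‖x‖)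
    (hd : HasDerivAt c c' ‖x‖) (hZ : Z =ᶠ[nhds x] fun y => c ‖y‖ • y) :
    covDeriv (metric m g) Y Z x = (c ‖x‖ * ‖x‖ * g' / g ‖x‖) • Y x
      + ((c ‖x‖ + c' * ‖x‖ - c ‖x‖ * ‖x‖ * g' / g ‖x‖) / ‖x‖ ^ 2 * ⟪x, Y x⟫_ℝ) • x := by
  obtain ⟨hn, hgn⟩ := norm_ne_zero_and_warping_ne_zero hx hc
  rw [covDeriv_congr hZ, covDeriv_smul (Y := fun y => y) (hasFDerivAt_comp_norm hx hd)
    differentiableAt_id, covDeriv, christoffel_metric_self hx hc hg]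
  simp only [fderiv_fun_id, smul_apply, innerSL_apply_apply, smul_eq_mul,
    ContinuousLinearMap.id_apply]
  match_scalars
  · field_simp
    ring
  · field_simp
    ring

end Metric

/-! ### Radial gradients -/

section RadialGradient

variable {m : ℕ} {G g K : ℝ → ℝ} {x : EuclideanSpace ℝ (Fin m)}
  {Z : EuclideanSpace ℝ (Fin m) → EuclideanSpace ℝ (Fin m)}

theorem grad_eq_smul {u : EuclideanSpace ℝ (Fin m) → ℝ} {c : ℝ} (hc : x ∈ carrier m g)
    (hu : HasFDerivAt u (c • innerSL ℝ x) x) : grad (metric m g) u x = c • x := by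
  rw [grad, hu.fderiv, (isInvertible_metric hc).inverse_apply_eq]
  rcases eq_or_ne x 0 with rfl | hx
  · simp
  · ext w
    simp [metric_self_left hx]

theorem IsWarpingFunction.hasFDerivAt_primitive_norm (hg : IsWarpingFunction G g)
    (hG : ContDiff ℝ ∞ G) (he : ∀ t, G (-t) = G t) (A B : ℝ) (x : EuclideanSpace ℝ (Fin m)) :
    HasFDerivAt (fun x : EuclideanSpace ℝ (Fin m) => A * (∫ s in (0 : ℝ)..‖x‖, g s) + B)
      ((A * radialDeriv (warpingPrimitive g) ‖x‖) • innerSL ℝ x) x := by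
  have h := ((hasFDerivAt_comp_norm_of_even (hg.contDiff_primitive hG)
    (hg.primitive_even hG.continuous he) x).const_mul A).add_const B
  rw [smul_smul] at h
  exact h

theorem IsWarpingFunction.mul_radialDeriv_primitive (hg : IsWarpingFunction G g)
    (hG : ContDiff ℝ ∞ G) (he : ∀ t, G (-t) = G t) (t : ℝ) :
    t * radialDeriv (warpingPrimitive g) t = g t := by
  rw [mul_radialDeriv (hg.contDiff_primitive hG) (hg.primitive_even hG.continuous he),
    hg.deriv_primitive]

/-- The field `∇ (A ∫₀^r g)` is closed conformal. -/
theorem IsWarpingFunction.covDeriv_conformal (hg : IsWarpingFunction G g)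
    (hG : ContDiff ℝ ∞ G) (he : ∀ t, G (-t) = G t) {A : ℝ}
    (hZ : ∀ x ∈ carrier m g, Z x = (A * radialDeriv (warpingPrimitive g) ‖x‖) • x)
    (Y : EuclideanSpace ℝ (Fin m) → EuclideanSpace ℝ (Fin m)) (hc : x ∈ carrier m g) :
    covDeriv (metric m g) Y Z x = (A * deriv g ‖x‖) • Y x := by
  set φ := radialDeriv (warpingPrimitive g) with hφ
  have hφs : ContDiff ℝ ∞ φ := contDiff_radialDeriv (hg.contDiff_primitive hG)
  have hφe : ∀ t, φ (-t) = φ t := radialDeriv_neg (hg.primitive_even hG.continuous he)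
  have hφm : ∀ t, t * φ t = g t := hg.mul_radialDeriv_primitive hG he
  have hZe : Z =ᶠ[nhds x] fun y => (A * φ ‖y‖) • y := by
    filter_upwards [isOpen_carrier.mem_nhds hc] with y hy using hZ y hy
  rcases eq_or_ne x 0 with rfl | hx
  -- At the pole `Z` vanishes, so the Christoffel term drops out and no derivative of the metric is
  -- needed there.
  · have h0 : φ 0 = 1 := by
      rw [hφ, radialDeriv_zero, hg.deriv_primitive, hg.deriv_zero]
    rw [covDeriv_congr hZe, covDeriv_smul (Y := fun y => y)
      ((hasFDerivAt_comp_norm_of_even hφs hφe _).const_mul A) differentiableAt_fun_id, covDeriv]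
    simp [h0, hg.deriv_zero, christoffel_zero_right]
  · obtain ⟨hn, hgn⟩ := norm_ne_zero_and_warping_ne_zero hx hc
    have hφd : HasDerivAt φ (deriv φ ‖x‖) ‖x‖ := (hφs.differentiable (by simp) _).hasDerivAt
    have h1 : φ ‖x‖ + ‖x‖ * deriv φ ‖x‖ = deriv g ‖x‖ := by
      have h := (hasDerivAt_id' ‖x‖).fun_mul hφd
      simp only [hφm, one_mul] at h
      exact h.unique (hg.hasDerivAt _)
    rw [covDeriv_radial (c := fun t => A * φ t) hx hc (hg.hasDerivAt _) (hφd.const_mul A) hZe]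
    have h2 : A * φ ‖x‖ * ‖x‖ * deriv g ‖x‖ / g ‖x‖ = A * deriv g ‖x‖ := by
      rw [← hφm ‖x‖] at hgn ⊢
      have := right_ne_zero_of_mul hgn
      field_simp
    rw [h2, show A * φ ‖x‖ + A * deriv φ ‖x‖ * ‖x‖ - A * deriv g ‖x‖ = 0 by rw [← h1]; ring]
    simp

/-- By conformality `D_X (A g' Y) = A X(g') Y + A g' D_X Y`, and the last term is exactly `D_{D_X Y}
Z`. -/
theorem IsWarpingFunction.isSolution (hg : IsWarpingFunction G g)
    (hG : ContDiff ℝ ∞ G) (he : ∀ t, G (-t) = G t) {A : ℝ} (hK : ∀ t ∈ radii g, K t = G t)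
    (hZ : ∀ x ∈ carrier m g, Z x = (A * radialDeriv (warpingPrimitive g) ‖x‖) • x) :
    IsSolution m g K Z := by
  have hφs := contDiff_radialDeriv (hg.contDiff_primitive hG)
  have hφe := radialDeriv_neg (hg.primitive_even hG.continuous he)
  have hφm := hg.mul_radialDeriv_primitive hG he
  refine ⟨?_, fun X Y _ hY x hc => ?_⟩
  · refine ContDiffOn.congr ?_ hZ
    exact ((contDiff_const.mul (contDiff_comp_norm_of_even hφs hφe)).smul contDiff_id).contDiffOn
  · have hcov : covDeriv (metric m g) Y Z =ᶠ[nhds x] fun y => (A * deriv g ‖y‖) • Y y := by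
      filter_upwards [isOpen_carrier.mem_nhds hc] with y hy
      exact hg.covDeriv_conformal hG he hZ Y hy
    have hYd : DifferentiableAt ℝ Y x :=
      (hY.contDiffAt (isOpen_carrier.mem_nhds hc)).differentiableAt (by simp)
    -- Writing `g = r φ` turns `g''/r` into `G φ`, which makes sense at the pole too.
    have hf : HasFDerivAt (fun y : EuclideanSpace ℝ (Fin m) => deriv g ‖y‖)
        ((G ‖x‖ * radialDeriv (warpingPrimitive g) ‖x‖) • innerSL ℝ x) x := by
      rcases eq_or_ne x 0 with rfl | hx
      · have h0 := hg.ode 0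
        rw [hg.zero, mul_zero] at h0
        simpa using hasFDerivAt_comp_norm_zero (F := EuclideanSpace ℝ (Fin m)) h0
      · have h := hasFDerivAt_comp_norm hx (hg.ode ‖x‖)
        rwa [← hφm ‖x‖, mul_left_comm, mul_div_cancel_left₀ _ (norm_ne_zero_iff.mpr hx)] at h
    have hmet : metric m g x x = innerSL ℝ x := by
      rcases eq_or_ne x 0 with rfl | hx
      · simp
      · ext w
        exact metric_self_left hx w
    rw [secondCovDeriv, covDeriv_congr hcov, covDeriv_smul (hf.const_mul A) hYd,
      hg.covDeriv_conformal hG he hZ _ hc, hZ x hc, hK _ (mem_carrier_iff.mp hc), map_smul,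
      smul_apply, hmet, add_sub_cancel_right]
    congr 1
    simp only [smul_apply, smul_eq_mul]
    ring

end RadialGradient

/-! ### The system in polar coordinates -/

section Polar

variable {m : ℕ} {G g K z : ℝ → ℝ} {Z : EuclideanSpace ℝ (Fin m) → EuclideanSpace ℝ (Fin m)}

theorem exists_orthonormal_pair (hm : 2 ≤ m) :
    ∃ e τ : EuclideanSpace ℝ (Fin m), ‖e‖ = 1 ∧ ‖τ‖ = 1 ∧ ⟪e, τ⟫_ℝ = 0 := by
  refine ⟨EuclideanSpace.single ⟨0, by omega⟩ 1, EuclideanSpace.single ⟨1, by omega⟩ 1, ?_, ?_, ?_⟩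
  · simp
  · simp
  · rw [EuclideanSpace.inner_single_left]
    simp

/-- The radial and tangential components of `D_{∂_r} D Z = K z` for the field `Z = (z(r) / r) x`. -/
theorem polar_equations (hm : 2 ≤ m) (hg : IsWarpingFunction G g)
    (hsol : IsSolution m g K Z)
    (hz : ∀ t ∈ radii g, 0 < t → ContDiffAt ℝ ∞ z t)
    (hZ : ∀ x ∈ carrier m g, x ≠ 0 → Z x = (z ‖x‖ / ‖x‖) • x) {t : ℝ} (ht : t ∈ radii g)
    (h0 : 0 < t) :
    HasDerivAt (deriv z) (K t * z t) t ∧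
      HasDerivAt (fun s => z s * deriv g s / g s) (K t * z t) t := by
  obtain ⟨e, τ, he, hτ, heτ⟩ := exists_orthonormal_pair hm
  have hee : ⟪e, e⟫_ℝ = 1 := by rw [real_inner_self_eq_norm_sq, he, one_pow]
  have hgn := ne_zero_of_mem_radii ht h0
  set p : ℝ → ℝ := fun s => z s * deriv g s / g s with hp
  -- Chosen so that `D_V Z = p V + q ⟨x, V⟩ x`; the `s ^ 2` comes from using `x` in place of the
  -- unit vector `∂_r`.
  set q : ℝ → ℝ := fun s => (deriv z s - p s) / s ^ 2 with hq
  have hzs := hz t ht h0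
  have hz1 : ContDiffAt ℝ ∞ (deriv z) t := by
    have h := (hzs.fderiv_right (m := ∞) (by simp)).clm_apply
      (contDiffAt_const (c := (1 : ℝ)))
    exact h
  have hgd : DifferentiableAt ℝ (deriv g) t := (hg.ode t).differentiableAt
  have hpd : HasDerivAt p (deriv p t) t :=
    (((hzs.differentiableAt (by simp)).mul hgd).div (hg.differentiable t) hgn).hasDerivAt
  have hqd : HasDerivAt q (deriv q t) t :=
    (((hz1.differentiableAt (by simp)).sub hpd.differentiableAt).div
      (differentiableAt_pow 2) (pow_ne_zero 2 h0.ne')).hasDerivAt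
  obtain ⟨x, hx⟩ : ∃ x : EuclideanSpace ℝ (Fin m), x = t • e := ⟨_, rfl⟩
  have hnx : ‖x‖ = t := by rw [hx, norm_smul, he, Real.norm_of_nonneg h0.le, mul_one]
  have hx0 : x ≠ 0 := norm_ne_zero_iff.mp (by rw [hnx]; exact h0.ne')
  have hxc : x ∈ carrier m g := mem_carrier_iff.mpr (by rwa [hnx])
  have hcov : ∀ (V : EuclideanSpace ℝ (Fin m) → EuclideanSpace ℝ (Fin m)),
      ∀ y ∈ carrier m g, y ≠ 0 → covDeriv (metric m g) V Z y =
        p ‖y‖ • V y + (q ‖y‖ * ⟪y, V y⟫_ℝ) • y := by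
    intro V y hy hy0
    have hn : ‖y‖ ≠ 0 := norm_ne_zero_iff.mpr hy0
    have hzd := ((hz _ (mem_carrier_iff.mp hy) (norm_pos_iff.mpr hy0)).differentiableAt
      (by simp)).hasDerivAt
    rw [covDeriv_radial hy0 hy (hg.hasDerivAt _) (hzd.fun_div (hasDerivAt_id' _) hn)]
    · simp only [hp, hq]
      congr 2
      · field_simp
      · congr 1
        field_simp
        ring
    · filter_upwards [isOpen_carrier.mem_nhds hy, isOpen_ne.mem_nhds hy0] with w hw hw0
      exact hZ w hw hw0
  have hΓ : ∀ v, christoffel (metric m g) x e v = (t * deriv g t / g t - 1) •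
      ((1 / t) • (v - ⟪e, v⟫_ℝ • e)) := by
    intro v
    rw [christoffel_metric_symm hx0 (hg.hasDerivAt _) e v,
      show e = (1 / t) • x by rw [hx, smul_smul, one_div_mul_cancel h0.ne', one_smul],
      christoffel_smul_right, christoffel_metric_self hx0 hxc (hg.hasDerivAt _), hnx]
    simp only [real_inner_smul_left]
    match_scalars
    · field_simp
    · field_simp
  have hpx : HasFDerivAt (fun y : EuclideanSpace ℝ (Fin m) => p ‖y‖)
      ((deriv p t / t) • innerSL ℝ x) x := by
    have h := hasFDerivAt_comp_norm hx0 (hnx.symm ▸ hpd)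
    rwa [hnx] at h
  have hqx : HasFDerivAt (fun y : EuclideanSpace ℝ (Fin m) => q ‖y‖)
      ((deriv q t / t) • innerSL ℝ x) x := by
    have h := hasFDerivAt_comp_norm hx0 (hnx.symm ▸ hqd)
    rwa [hnx] at h
  have hxe : ⟪x, e⟫_ℝ = t := by rw [hx, real_inner_smul_left, hee, mul_one]
  -- Constant fields `X = e`, `Y = v` suffice; `D_X Y` is then the Christoffel term `Γ(e, v)`.
  have hmain : ∀ v, (K t * z t) • v = deriv p t • v
      + (deriv q t * (t * ⟪e, v⟫_ℝ) + q t * ⟪e, v⟫_ℝ) • x + (q t * (t * ⟪e, v⟫_ℝ)) • e := by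
    intro v
    have hin : HasFDerivAt (fun y : EuclideanSpace ℝ (Fin m) => ⟪y, v⟫_ℝ) (innerSL ℝ v) x := by
      simpa only [← innerSL_apply_apply ℝ v, real_inner_comm] using
        (innerSL ℝ v).hasFDerivAt (x := x)
    have hD := (hpx.smul_const v).fun_add ((hqx.fun_mul hin).fun_smul (hasFDerivAt_id x))
    have h := hsol.2 (fun _ => e) (fun _ => v) contDiffOn_const contDiffOn_const x hxc
    have hev : covDeriv (metric m g) (fun _ => v) Z =ᶠ[nhds x]
        fun y => p ‖y‖ • v + (q ‖y‖ * ⟪y, v⟫_ℝ) • y := by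
      filter_upwards [isOpen_carrier.mem_nhds hxc, isOpen_ne.mem_nhds hx0] with w hw hw0
      exact hcov _ w hw hw0
    have hxv : ⟪x, v⟫_ℝ = t * ⟪e, v⟫_ℝ := by rw [hx, real_inner_smul_left]
    rw [secondCovDeriv, hcov _ x hxc hx0, covDeriv_congr hev, hZ x hxc hx0, map_smul,
      smul_apply, metric_self_left hx0, hxe, hnx, covDeriv, covDeriv] at h
    have hfd := hD.fderiv
    simp only [id] at hfd
    rw [hfd] at h
    rw [show K t * z t = K t * (z t / t) • t by rw [smul_eq_mul, div_mul_cancel₀ _ h0.ne'], ← h]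
    simp only [hnx, hxv, hΓ, hxe, fderiv_const_apply, zero_apply, zero_add, add_apply, smul_apply,
      ContinuousLinearMap.smulRight_apply, innerSL_apply_apply, inner_add_right, inner_sub_right,
      inner_smul_right, real_inner_comm e v, smul_eq_mul, ContinuousLinearMap.id_apply]
    rw [hx]
    simp only [inner_smul_right, hee]
    match_scalars
    · field_simp
      ring
    · field_simp
      ring
  constructor
  -- For `v = e` the right side is the derivative of `p + q s² = z'`.
  · have h1 := congrArg (fun v => ⟪e, v⟫_ℝ) (hmain e)
    simp only [inner_add_right, inner_smul_right, hee, hx] at h1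
    have h2 := hpd.fun_add (hqd.fun_mul (hasDerivAt_pow 2 t))
    have h3 : deriv z =ᶠ[nhds t] fun s => p s + q s * s ^ 2 := by
      filter_upwards [lt_mem_nhds h0] with s hs
      simp only [hq]
      rw [div_mul_cancel₀ _ (pow_ne_zero 2 hs.ne')]
      ring
    refine (h2.congr_of_eventuallyEq h3).congr_deriv ?_
    simp only [mul_one] at h1
    rw [h1]
    simp
    ring
  -- Only `p'` survives for `v = τ`. A direction orthogonal to `e` exists because `m ≥ 2`.
  · have h1 := congrArg (fun v => ⟪τ, v⟫_ℝ) (hmain τ)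
    simp only [heτ, mul_zero, zero_smul, add_zero, inner_smul_right, real_inner_self_eq_norm_sq,
      hτ, one_pow, mul_one] at h1
    rw [h1]
    exact hpd

end Polar

/-! ### Rigidity -/

section Rigidity

variable {m : ℕ} {G g K z : ℝ → ℝ} {Z : EuclideanSpace ℝ (Fin m) → EuclideanSpace ℝ (Fin m)}

theorem isOpen_posRadii : IsOpen {t | t ∈ radii g ∧ 0 < t} :=
  isOpen_iff_mem_nhds.mpr fun _ ht => eventually_mem_radii ht.1 ht.2

theorem isPreconnected_posRadii : IsPreconnected {t | t ∈ radii g ∧ 0 < t} := by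
  refine Set.OrdConnected.isPreconnected ⟨fun s hs t ht r hr => ?_⟩
  have h0 : 0 < r := hs.2.trans_le hr.1
  exact ⟨mem_radii_of_le ht.1 h0.le hr.2, h0⟩

theorem eq_on_posRadii_of_hasDerivAt_zero {f : ℝ → ℝ}
    (hf : ∀ t ∈ radii g, 0 < t → HasDerivAt f 0 t) {s t : ℝ} (hs : s ∈ radii g) (hs0 : 0 < s)
    (ht : t ∈ radii g) (ht0 : 0 < t) : f s = f t :=
  (isOpen_posRadii (g := g)).is_const_of_deriv_eq_zero isPreconnected_posRadii
    (fun r hr => (hf r hr.1 hr.2).differentiableAt.differentiableWithinAt)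
    (fun r hr => (hf r hr.1 hr.2).deriv) ⟨hs, hs0⟩ ⟨ht, ht0⟩

theorem tendsto_nhdsGT_of_continuousOn_radii (hg : IsWarpingFunction G g)
    (hK : ContinuousOn K (radii g)) :
    Filter.Tendsto K (nhdsWithin 0 (Set.Ioi 0)) (nhds (K 0)) := by
  refine (hK 0 hg.zero_mem_radii).tendsto.mono_left (nhdsWithin_le_iff.mpr ?_)
  filter_upwards [eventually_mem_radii_nhdsGT hg] with s hs using hs.1

theorem proportional_of_polar_equations (hg : IsWarpingFunction G g) (hG : Continuous G)
    (hK : ContinuousOn K (radii g))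
    (hz : ∀ t ∈ radii g, 0 < t → DifferentiableAt ℝ z t)
    (hrad : ∀ t ∈ radii g, 0 < t → HasDerivAt (deriv z) (K t * z t) t)
    (htan : ∀ t ∈ radii g, 0 < t → HasDerivAt (fun s => z s * deriv g s / g s) (K t * z t) t)
    (hz0 : Filter.Tendsto z (nhdsWithin 0 (Set.Ioi 0)) (nhds 0)) :
    (∃ A, ∀ t ∈ radii g, 0 < t → z t = A * g t) ∧
      ∀ t ∈ radii g, 0 < t → K t * z t = G t * z t := by
  obtain ⟨t₀, ht₀, h0₀⟩ := hg.exists_pos_mem_radii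
  obtain ⟨C, hC⟩ : ∃ C, ∀ t ∈ radii g, 0 < t → deriv z t * g t - z t * deriv g t = C * g t := by
    refine ⟨deriv z t₀ - z t₀ * deriv g t₀ / g t₀, fun t ht h0 => ?_⟩
    have h := eq_on_posRadii_of_hasDerivAt_zero (g := g)
      (f := fun s => deriv z s - z s * deriv g s / g s)
      (fun t ht h0 => by simpa using (hrad t ht h0).fun_sub (htan t ht h0)) ht₀ h0₀ ht h0
    have hgn := ne_zero_of_mem_radii ht h0
    rw [h]
    field_simp
  have hKG : ∀ t ∈ radii g, 0 < t → (K t - G t) * z t * g t = C * deriv g t := by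
    intro t ht h0
    have hgn := ne_zero_of_mem_radii ht h0
    have h := (((hz t ht h0).hasDerivAt.fun_mul (hg.ode t)).fun_div
      (hg.hasDerivAt t) hgn).unique (htan t ht h0)
    have hCt := hC t ht h0
    rw [div_eq_iff (pow_ne_zero 2 hgn)] at h
    refine mul_right_cancel₀ hgn ?_
    linear_combination deriv g t * hCt - h
  -- Let `t → 0⁺` in `hKG`: `K - G` stays bounded, `z` and `g` tend to `0`, and `g'` tends to `1`.
  have hC0 : C = 0 := by
    have hl {f : ℝ → ℝ} (hf : ContinuousAt f 0) :
        Filter.Tendsto f (nhdsWithin 0 (Set.Ioi 0)) (nhds (f 0)) :=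
      hf.tendsto.mono_left nhdsWithin_le_nhds
    have h1 := (((tendsto_nhdsGT_of_continuousOn_radii hg hK).sub
      (hl hG.continuousAt)).mul hz0).mul (hl (hg.differentiable 0).continuousAt)
    have h2 := (hl (hg.ode 0).continuousAt).const_mul C
    have h3 := tendsto_nhds_unique_of_eventuallyEq h1 h2 (by
      filter_upwards [eventually_mem_radii_nhdsGT hg] with s hs using hKG s hs.1 hs.2)
    rw [hg.deriv_zero] at h3
    linarith
  subst hC0
  refine ⟨⟨z t₀ / g t₀, fun t ht h0 => ?_⟩, fun t ht h0 => ?_⟩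
  · have h := eq_on_posRadii_of_hasDerivAt_zero (g := g) (f := fun s => z s / g s)
      (fun t ht h0 => by
        have h := (hz t ht h0).hasDerivAt.fun_div (hg.hasDerivAt t) (ne_zero_of_mem_radii ht h0)
        rwa [hC t ht h0, zero_mul, zero_div] at h) ht₀ h0₀ ht h0
    rw [h, div_mul_cancel₀ _ (ne_zero_of_mem_radii ht h0)]
  · have h := hKG t ht h0
    rw [zero_mul] at h
    have h1 := (mul_eq_zero.mp h).resolve_right (ne_zero_of_mem_radii ht h0)
    linarith

/-- Invariance under `x ↦ -x` makes the differential at the origin its own negative. Nothing is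
assumed of `α`, whose values at negative arguments are arbitrary. -/
theorem fderiv_comp_norm_zero {F : Type*} [NormedAddCommGroup F] [NormedSpace ℝ F] (α : ℝ → ℝ) :
    fderiv ℝ (fun x : F => α ‖x‖) 0 = 0 := by
  by_cases hd : DifferentiableAt ℝ (fun x : F => α ‖x‖) 0
  · have h1 := hd.hasFDerivAt
    rw [← neg_zero (G := F)] at h1
    have h2 := h1.comp 0 (hasFDerivAt_id (𝕜 := ℝ) (0 : F)).neg
    have h3 : ((fun x : F => α ‖x‖) ∘ Neg.neg) = fun x : F => α ‖x‖ := by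
      ext x
      simp
    rw [h3, neg_zero] at h2
    have h4 := h2.unique hd.hasFDerivAt
    ext v
    have h5 := congrArg (fun L => L v) h4
    simp at h5
    rw [zero_apply]
    linarith
  · exact fderiv_zero_of_not_differentiableAt hd

theorem IsNontrivialRadialGradientSolution.rigid (hm : 2 ≤ m) (hg : IsWarpingFunction G g)
    (hG : ContDiff ℝ ∞ G) (he : ∀ t, G (-t) = G t) (hK : ContDiffOn ℝ ∞ K (radii g))
    (h : IsNontrivialRadialGradientSolution m g K Z) :
    (∃ A, A ≠ 0 ∧ ∀ x ∈ carrier m g, Z x = (A * radialDeriv (warpingPrimitive g) ‖x‖) • x) ∧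
      ∀ t ∈ radii g, K t = G t := by
  obtain ⟨α, hα, hgrad⟩ := h.radial
  obtain ⟨e, _, hne, _, _⟩ := exists_orthonormal_pair hm
  have hee : ⟪e, e⟫_ℝ = 1 := by rw [real_inner_self_eq_norm_sq, hne, one_pow]
  have hnorm : ∀ t : ℝ, 0 < t → ‖t • e‖ = t := fun t h0 => by
    rw [norm_smul, hne, Real.norm_of_nonneg h0.le, mul_one]
  -- Smoothness of `α` is read off by restricting `u` to the ray through `e`.
  have hαs : ∀ t ∈ radii g, 0 < t → ContDiffAt ℝ ∞ α t := by
    intro t ht h0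
    have hc : t • e ∈ carrier m g := mem_carrier_iff.mpr (by rwa [hnorm t h0])
    have h1 := (hα.contDiffAt (isOpen_carrier.mem_nhds hc)).comp t
      (contDiff_id.smul (contDiff_const (c := e))).contDiffAt
    refine h1.congr_of_eventuallyEq ?_
    filter_upwards [lt_mem_nhds h0] with s hs
    simp [hnorm s hs]
  set z := deriv α with hzdef
  have hzs : ∀ t ∈ radii g, 0 < t → ContDiffAt ℝ ∞ z t := by
    intro t ht h0
    have h := ((hαs t ht h0).fderiv_right (m := ∞) (by simp)).clm_apply
      (contDiffAt_const (c := (1 : ℝ)))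
    exact h
  have hZ : ∀ x ∈ carrier m g, x ≠ 0 → Z x = (z ‖x‖ / ‖x‖) • x := by
    intro x hc hx
    have hd := ((hαs _ (mem_carrier_iff.mp hc) (norm_pos_iff.mpr hx)).differentiableAt
      (by simp)).hasDerivAt
    rw [hgrad x hc, grad_eq_smul hc (hasFDerivAt_comp_norm hx hd)]
  have h0c : (0 : EuclideanSpace ℝ (Fin m)) ∈ carrier m g :=
    mem_carrier_iff.mpr (by simpa using hg.zero_mem_radii)
  have hZ0 : Z 0 = 0 := by
    rw [hgrad 0 h0c, grad, fderiv_comp_norm_zero, map_zero]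
  -- Along that ray `z(t) = ⟨e, Z(t e)⟩`, and `Z` is continuous with `Z 0 = 0`.
  have hz0 : Filter.Tendsto z (nhdsWithin 0 (Set.Ioi 0)) (nhds 0) := by
    have hZc : ContinuousAt Z ((0 : ℝ) • e) := by
      rw [zero_smul]
      exact (h.solution.1.contDiffAt (isOpen_carrier.mem_nhds h0c)).continuousAt
    have h1 : ContinuousAt (fun t : ℝ => ⟪e, Z (t • e)⟫_ℝ) 0 :=
      ContinuousAt.inner continuousAt_const (hZc.comp (f := fun t : ℝ => t • e) (by fun_prop))
    have h2 := h1.tendsto.mono_left (nhdsWithin_le_nhds (s := Set.Ioi 0))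
    simp only [zero_smul, hZ0, inner_zero_right] at h2
    refine h2.congr' ?_
    filter_upwards [eventually_mem_radii_nhdsGT hg] with s hs
    have hn := hnorm s hs.2
    rw [hZ _ (mem_carrier_iff.mpr (by rw [hn]; exact hs.1))
      (norm_ne_zero_iff.mp (by rw [hn]; exact hs.2.ne')), hn, smul_smul,
      div_mul_cancel₀ _ hs.2.ne', inner_smul_right, hee, mul_one]
  have hpol := fun t ht h0 => polar_equations hm hg h.solution hzs hZ (t := t) ht h0
  obtain ⟨⟨A, hA⟩, hKG⟩ := proportional_of_polar_equations hg hG.continuous hK.continuousOn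
    (fun t ht h0 => (hzs t ht h0).differentiableAt (by simp)) (fun t ht h0 => (hpol t ht h0).1)
    (fun t ht h0 => (hpol t ht h0).2) hz0
  have hZA : ∀ x ∈ carrier m g, Z x = (A * radialDeriv (warpingPrimitive g) ‖x‖) • x := by
    intro x hc
    rcases eq_or_ne x 0 with rfl | hx
    · rw [hZ0, smul_zero]
    · rw [hZ x hc hx, hA _ (mem_carrier_iff.mp hc) (norm_pos_iff.mpr hx),
        ← hg.mul_radialDeriv_primitive hG he, mul_left_comm,
        mul_div_cancel_left₀ _ (norm_ne_zero_iff.mpr hx)]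
  have hA0 : A ≠ 0 := by
    rintro rfl
    obtain ⟨x, hc, hx⟩ := h.nontrivial
    exact hx (by rw [hZA x hc, zero_mul, zero_smul])
  have hKpos : ∀ t ∈ radii g, 0 < t → K t = G t := by
    intro t ht h0
    refine mul_right_cancel₀ ?_ (hKG t ht h0)
    rw [hA t ht h0]
    exact mul_ne_zero hA0 (ne_zero_of_mem_radii ht h0)
  refine ⟨⟨A, hA0, hZA⟩, fun t ht => ?_⟩
  -- At `t = 0` there is nothing to divide by, as `g 0 = 0`; equality follows by continuity from the
  -- right.
  rcases ht.1.eq_or_lt with rfl | h0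
  · refine tendsto_nhds_unique_of_eventuallyEq
      (tendsto_nhdsGT_of_continuousOn_radii hg hK.continuousOn)
      (hG.continuous.continuousAt.tendsto.mono_left nhdsWithin_le_nhds) ?_
    filter_upwards [eventually_mem_radii_nhdsGT hg] with s hs using hKpos s hs.1 hs.2
  · exact hKpos t ht h0

theorem IsWarpingFunction.isNontrivialRadialGradientSolution (hm : 2 ≤ m)
    (hg : IsWarpingFunction G g) (hG : ContDiff ℝ ∞ G) (he : ∀ t, G (-t) = G t)
    (hK : ∀ t ∈ radii g, K t = G t) {A B : ℝ} (hA : A ≠ 0)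
    (hZ : ∀ x ∈ carrier m g, Z x = grad (metric m g)
      (fun x => A * (∫ s in (0 : ℝ)..‖x‖, g s) + B) x) :
    IsNontrivialRadialGradientSolution m g K Z := by
  have hZA : ∀ x ∈ carrier m g, Z x = (A * radialDeriv (warpingPrimitive g) ‖x‖) • x :=
    fun x hc => by rw [hZ x hc, grad_eq_smul hc (hg.hasFDerivAt_primitive_norm hG he A B x)]
  refine ⟨hg.isSolution hG he hK hZA, ⟨fun t => A * (∫ s in (0 : ℝ)..t, g s) + B, ?_, hZ⟩, ?_⟩
  · exact ((contDiff_const.mul (contDiff_comp_norm_of_even (hg.contDiff_primitive hG)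
      (hg.primitive_even hG.continuous he))).add contDiff_const).contDiffOn
  · obtain ⟨e, _, hne, _, _⟩ := exists_orthonormal_pair hm
    obtain ⟨t, ht, h0⟩ := hg.exists_pos_mem_radii
    have hn : ‖t • e‖ = t := by rw [norm_smul, hne, Real.norm_of_nonneg h0.le, mul_one]
    have hc : t • e ∈ carrier m g := mem_carrier_iff.mpr (by rwa [hn])
    refine ⟨t • e, hc, ?_⟩
    have hgn := ne_zero_of_mem_radii ht h0
    rw [← hg.mul_radialDeriv_primitive hG he] at hgn
    rw [hZA _ hc, hn]
    exact smul_ne_zero (mul_ne_zero hA (right_ne_zero_of_mul hgn))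
      (norm_ne_zero_iff.mp (by rw [hn]; exact h0.ne'))

end Rigidity

end ModelManifold

end

theorem lemma3p1 (m : ℕ) (hm : 2 ≤ m) (G : ℝ → ℝ) (hG : ContDiff ℝ ∞ G)
    (hGeven : ∀ t, G (-t) = G t) (g : ℝ → ℝ) (hg : ModelManifold.IsWarpingFunction G g)
    (K : ℝ → ℝ) (hK : ContDiffOn ℝ ∞ K (ModelManifold.radii g)) :
    ((∃ Z : EuclideanSpace ℝ (Fin m) → EuclideanSpace ℝ (Fin m),
        ModelManifold.IsNontrivialRadialGradientSolution m g K Z) ↔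
      ∀ t ∈ ModelManifold.radii g, K t = G t) ∧
    ((∀ t ∈ ModelManifold.radii g, K t = G t) →
      ∀ Z : EuclideanSpace ℝ (Fin m) → EuclideanSpace ℝ (Fin m),
        ModelManifold.IsNontrivialRadialGradientSolution m g K Z ↔
          ∃ A B : ℝ, A ≠ 0 ∧ ∀ x ∈ ModelManifold.carrier m g,
            Z x = ModelManifold.grad (ModelManifold.metric m g)
              (fun x => A * (∫ s in (0 : ℝ)..‖x‖, g s) + B) x) := by
  refine ⟨⟨fun ⟨Z, hZ⟩ => (hZ.rigid hm hg hG hGeven hK).2, fun h => ?_⟩,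
    fun h Z => ⟨fun hZ => ?_, ?_⟩⟩
  · exact ⟨_, hg.isNontrivialRadialGradientSolution hm hG hGeven h (A := 1) (B := 0) one_ne_zero
      fun x _ => rfl⟩
  · obtain ⟨A, hA, hZA⟩ := (hZ.rigid hm hg hG hGeven hK).1
    -- The gradient does not see `B`, so `0` serves.
    refine ⟨A, 0, hA, fun x hc => ?_⟩
    rw [hZA x hc,
      ModelManifold.grad_eq_smul hc (hg.hasFDerivAt_primitive_norm hG hGeven A 0 x)]
  · rintro ⟨A, B, hA, hZ⟩
    exact hg.isNontrivialRadialGradientSolution hm hG hGeven h hA hZ
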